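/- Let $M$ be a finite matroid with ground set $E$ and rank function $r$. For a finite tree $T$ let $\|T\|$ be its number of edges. A depth-decomposition of $M$ is a pair $(T,f)$, where $T$ is a finite rooted tree and $f:E\to V(T)$ is a map such that $r(E)=\|T\|$ and $r(X)\le\|T^*(X)\|$ for every $X\subseteq E$; here $T^*(X)$ is the union of the paths in $T$ from the root to the vertices of $f(X)$ (with no edges if $X=\emptyset$). The depth of a rooted tree is the length (number of edges) of a longest path from the root to a leaf, a one-vertex tree having depth $0$. The branch-depth $\mathrm{bd}(M)$ is the smallest depth of a rooted tree $T$ such that some $(T,f)$ is a depth-decomposition of $M$. If $M$ has at least one circuit and $\ell$ is the size of the largest circuit of $M$, then $$\mathrm{bd}(M)\le \ell^2 .$$ -/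

import Mathlib

namespace SimpleGraph

/-- The depth of the tree `T` rooted at `root`: the length of a longest path starting at the root.
(In a finite tree such a path ends in a leaf.) -/
noncomputable def rootedDepth {V : Type*} (T : SimpleGraph V) (root : V) : ℕ∞ :=
  ⨆ (v : V) (p : T.Path root v), (p.1.length : ℕ∞)

/-- The edges of the union of the paths of `T` from the root to the vertices in `S`. -/
def rootPathEdges {V : Type*} (T : SimpleGraph V) (root : V) (S : Set V) : Set (Sym2 V) :=
  {e | ∃ v ∈ S, ∃ p : T.Path root v, e ∈ p.1.edges}

end SimpleGraph

namespace Matroid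

/-- `(T, f)`, with `T` rooted at `root`, is a depth-decomposition of `M`: the tree `T` has exactly
`r(M)` edges, and every set `X` of elements of `M` has rank at most the number of edges of
the union of the paths from the root to the vertices in `f(X)`.
Only the values of `f` on the ground set of `M` matter. -/
structure IsDepthDecomposition {α V : Type*} (M : Matroid α)
    (T : SimpleGraph V) (root : V) (f : α → V) : Prop where
  isTree : T.IsTree
  eRank_eq : M.eRank = T.edgeSet.encard
  eRk_le : ∀ X ⊆ M.E, M.eRk X ≤ (T.rootPathEdges root (f '' X)).encard

/-- The branch-depth of `M`: the smallest depth of a (finite) rooted tree `T` for which some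
`(T, f)` is a depth-decomposition of `M`. The value would be `⊤` if there were none. -/
noncomputable def branchDepth {α : Type*} (M : Matroid α) : ℕ∞ :=
  sInf {d | ∃ (V : Type) (_ : Finite V) (T : SimpleGraph V) (root : V) (f : α → V),
    M.IsDepthDecomposition T root f ∧ T.rootedDepth root = d}

end Matroid

namespace Matroid

open Set

variable {α : Type*} {M : Matroid α} {A B C D Y Z : Set α} {e x y z : α}

/-- Two elements that lie in intersecting circuits lie in a common circuit. -/
lemma IsCircuit.exists_isCircuit_mem_mem [M.Finite] (hA : M.IsCircuit A) (hB : M.IsCircuit B)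
    (hAB : (A ∩ B).Nonempty) (hx : x ∈ A) (hz : z ∈ B) : ∃ Z, M.IsCircuit Z ∧ x ∈ Z ∧ z ∈ Z := by
  induction hn : (A ∪ B).ncard using Nat.strong_induction_on generalizing A B with
  | _ n ih =>
  have hfin : (A ∪ B).Finite := M.ground_finite.subset (union_subset hA.subset_ground hB.subset_ground)
  by_cases hxB : x ∈ B
  · exact ⟨B, hB, hxB, hz⟩
  by_cases hzA : z ∈ A
  · exact ⟨A, hA, hx, hzA⟩
  obtain ⟨y, hyA, hyB⟩ := hAB
  obtain ⟨A', hA's, hA', hxA'⟩ := hA.strong_elimination hB hyA hyB hx hxB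
  obtain ⟨B', hB's, hB', hzB'⟩ := hB.strong_elimination hA hyB hyA hz hzA
  have hmeet : (A' ∩ (B \ A)).Nonempty := by
    by_contra! h
    have hsub : A' ⊆ A \ {y} := fun u hu ↦ by
      have h1 := hA's hu
      have h2 : u ∉ A' ∩ (B \ A) := by simp [h]
      grind
    have := hA'.eq_of_subset_isCircuit hA (hsub.trans sdiff_subset)
    exact (hsub (this ▸ hyA)).2 rfl
  have hmeet' : (B' ∩ (A \ B)).Nonempty := by
    by_contra! h
    have hsub : B' ⊆ B \ {y} := fun u hu ↦ by
      have h1 := hB's hu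
      have h2 : u ∉ B' ∩ (A \ B) := by simp [h]
      grind
    have := hB'.eq_of_subset_isCircuit hB (hsub.trans sdiff_subset)
    exact (hsub (this ▸ hyB)).2 rfl
  by_cases hAA : A \ B ⊆ A'
  · refine ih _ ?_ hA' hB' ?_ hxA' hzB' rfl
    · rw [← hn]
      refine ncard_lt_ncard ⟨?_, fun h ↦ ?_⟩ hfin
      · exact union_subset (fun u hu ↦ (hA's hu).1) (fun u hu ↦ (hB's hu).1.symm)
      · rcases h (Or.inl hyA) with h | h
        · exact (hA's h).2 rfl
        · exact (hB's h).2 rfl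
    · obtain ⟨u, hu, hu'⟩ := hmeet'
      exact ⟨u, hAA hu', hu⟩
  · refine ih _ ?_ hA' hB ?_ hxA' hz rfl
    · rw [← hn]
      refine ncard_lt_ncard ⟨?_, fun h ↦ hAA fun u hu ↦ ?_⟩ hfin
      · exact union_subset (fun u hu ↦ (hA's hu).1) subset_union_right
      · exact (h (Or.inl hu.1)).resolve_right hu.2
    · obtain ⟨u, hu, hu'⟩ := hmeet
      exact ⟨u, hu, hu'.1⟩

/-- If two distinct elements are in no common circuit, then they are separated by a set `S` with
`r(S) + r(E \ S) = r(M)`. -/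
lemma exists_eRk_add_eRk_compl_eq [M.Finite] (hx : x ∈ M.E) (hxy : x ≠ y)
    (h : ¬ ∃ Z, M.IsCircuit Z ∧ x ∈ Z ∧ y ∈ Z) :
    ∃ S ⊆ M.E, x ∈ S ∧ y ∉ S ∧ M.eRk S + M.eRk (M.E \ S) = M.eRank := by
  set S : Set α := insert x {z | ∃ Z, M.IsCircuit Z ∧ x ∈ Z ∧ z ∈ Z} with hS
  have hSE : S ⊆ M.E := by
    rintro z (rfl | ⟨Z, hZ, -, hz⟩)
    · exact hx
    · exact hZ.subset_ground hz
  have hsep : ∀ Z, M.IsCircuit Z → (Z ∩ S).Nonempty → Z ⊆ S := by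
    rintro Z hZ ⟨u, huZ, rfl | ⟨Y, hY, hxY, huY⟩⟩ z hz
    · exact Or.inr ⟨Z, hZ, huZ, hz⟩
    · exact Or.inr (hY.exists_isCircuit_mem_mem hZ ⟨u, huY, huZ⟩ hxY hz)
  refine ⟨S, hSE, Or.inl rfl, ?_, ?_⟩
  · rintro (h' | h')
    · exact hxy h'.symm
    · exact h h'
  obtain ⟨I, hI⟩ := M.exists_isBasis S
  obtain ⟨J, hJ⟩ := M.exists_isBasis (M.E \ S)
  refine le_antisymm ?_ ?_
  · rw [← hI.encard_eq_eRk, ← hJ.encard_eq_eRk, ← encard_union_eq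
      (disjoint_sdiff_right.mono hI.subset hJ.subset)]
    refine Indep.encard_le_eRank ?_
    rw [indep_iff_forall_subset_not_isCircuit
      (union_subset hI.indep.subset_ground hJ.indep.subset_ground)]
    intro Z hZs hZ
    by_cases hZS : (Z ∩ S).Nonempty
    · refine (hI.indep.subset fun z hz ↦ ?_).not_dep hZ.dep
      exact (hZs hz).resolve_right fun h ↦ (hJ.subset h).2 (hsep Z hZ hZS hz)
    · refine (hJ.indep.subset fun z hz ↦ ?_).not_dep hZ.dep
      exact (hZs hz).resolve_left fun h ↦ hZS ⟨z, hz, hI.subset h⟩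
  · rw [← eRk_ground]
    simpa [union_sdiff_cancel hSE] using M.eRk_union_le_eRk_add_eRk S (M.E \ S)

/-- Let `Z` be a circuit that meets `C` and `D` and whose part `W` outside `C ∪ D` is minimal.
Then the only circuit in `W ∪ D` is `D`. -/
lemma IsCircuit.eq_of_subset_union_sdiff (hD : M.IsCircuit D) (hZ : M.IsCircuit Z)
    (hCD : Disjoint C D) (hZC : (Z ∩ C).Nonempty)
    (hmin : ∀ Y, M.IsCircuit Y → (Y ∩ C).Nonempty → (Y ∩ D).Nonempty → Y ⊆ Z ∪ C ∪ D →
      Z \ (C ∪ D) ⊆ Y)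
    (hY : M.IsCircuit Y) (hYs : Y ⊆ D ∪ (Z \ (C ∪ D))) : Y = D := by
  refine hY.eq_of_subset_isCircuit hD fun w hw ↦ ?_
  by_contra hwD
  have hwW := (hYs hw).resolve_left hwD
  obtain ⟨a, haZ, haC⟩ := hZC
  have haD : a ∉ D := fun h ↦ hCD.ne_of_mem haC h rfl
  have haY : a ∉ Y := fun h ↦ ((hYs h).resolve_left haD).2 (Or.inl haC)
  obtain ⟨Y', hY's, hY', haY'⟩ := hZ.strong_elimination hY hwW.1 hw haZ haY
  by_cases hYD : (Y' ∩ D).Nonempty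
  · refine (hY's (hmin Y' hY' ⟨a, haY', haC⟩ hYD (fun u hu ↦ ?_) hwW)).2 rfl
    have h1 := hY's hu
    have h2 := @hYs u
    grind
  · have hsub : Y' ⊆ Z := fun u hu ↦ by
      have h1 := hY's hu
      have h2 := @hYs u
      have h3 : u ∉ D := fun h ↦ hYD ⟨u, hu, h⟩
      grind
    have := hY'.eq_of_subset_isCircuit hZ hsub
    exact (hY's (this ▸ hwW.1)).2 rfl

/-- Let `Z` be a circuit that meets `C` and `D` and whose part outside `C ∪ D` is nonempty and
minimal. Some circuit agrees with `Z` outside `C` and together with `Z` covers `C`. -/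
lemma IsCircuit.exists_complementary (hC : M.IsCircuit C) (hD : M.IsCircuit D)
    (hZ : M.IsCircuit Z) (hCD : Disjoint C D) (hZC : (Z ∩ C).Nonempty) (hZD : (Z ∩ D).Nonempty)
    (hmin : ∀ Y, M.IsCircuit Y → (Y ∩ C).Nonempty → (Y ∩ D).Nonempty → Y ⊆ Z ∪ C ∪ D →
      Z \ (C ∪ D) ⊆ Y) (hW : (Z \ (C ∪ D)).Nonempty) :
    ∃ Z', M.IsCircuit Z' ∧ (Z' ∩ C).Nonempty ∧ Z' \ C = Z \ C ∧ C ⊆ Z ∪ Z' := by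
  obtain ⟨a, haZ, haC⟩ := hZC
  obtain ⟨d, hdZ, hdD⟩ := hZD
  obtain ⟨w, hwZ, hw⟩ := hW
  have hdC : d ∉ C := fun h ↦ hCD.ne_of_mem h hdD rfl
  obtain ⟨Z', hZ's, hZ', hdZ'⟩ := hZ.strong_elimination hC haZ haC hdZ hdC
  have hZ'C : (Z' ∩ C).Nonempty := by
    by_contra! h
    have hsub : Z' ⊆ Z := fun u hu ↦ by
      have h2 : u ∉ Z' ∩ C := by simp [h]
      exact (hZ's hu).1.resolve_right fun h ↦ h2 ⟨hu, h⟩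
    have := hZ'.eq_of_subset_isCircuit hZ hsub
    exact (hZ's (this ▸ haZ)).2 rfl
  have hWZ' : Z \ (C ∪ D) ⊆ Z' :=
    hmin Z' hZ' hZ'C ⟨d, hdZ', hdD⟩ fun u hu ↦ Or.inl (hZ's hu).1
  have hmin' : ∀ Y, M.IsCircuit Y → (Y ∩ D).Nonempty → (Y ∩ C).Nonempty → Y ⊆ Z ∪ D ∪ C →
      Z \ (D ∪ C) ⊆ Y := fun Y hY h1 h2 hs ↦ by
    rw [union_comm D C]
    exact hmin Y hY h2 h1 (hs.trans (by rw [union_right_comm]))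
  have hDZ : D ∩ Z ⊆ Z' := by
    rintro f ⟨hfD, hfZ⟩
    by_contra hfZ'
    obtain ⟨Y, hYs, hY, hfY⟩ := hZ.strong_elimination hZ' hwZ (hWZ' ⟨hwZ, hw⟩) hfZ hfZ'
    have hYsub : Y ⊆ Z ∪ C ∪ D := fun u hu ↦ by
      have h1 := hYs hu
      have h2 := @hZ's u
      grind
    have hYC : ∀ u ∈ Y, u ∉ C := fun u hu huC ↦
      (hYs (hmin Y hY ⟨u, hu, huC⟩ ⟨f, hfY, hfD⟩ hYsub ⟨hwZ, hw⟩)).2 rfl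
    have hYD : Y = D := by
      refine hD.eq_of_subset_union_sdiff hZ hCD ⟨a, haZ, haC⟩ hmin hY fun u hu ↦ ?_
      have h1 := hYs hu
      have h2 := @hZ's u
      have h3 := hYC u hu
      grind
    have hDsub : D ⊆ Z := fun u hu ↦ by
      have h1 := hYs (hYD ▸ hu)
      have h2 := @hZ's u
      have h3 := hYC u (hYD ▸ hu)
      grind
    have := hD.eq_of_subset_isCircuit hZ hDsub
    exact hw (Or.inr (this ▸ hwZ))
  refine ⟨Z', hZ', hZ'C, ?_, ?_⟩
  · ext u
    have h1 := @hZ's u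
    have h2 := @hWZ' u
    have h3 := @hDZ u
    grind
  · have haZ' : a ∉ Z' := fun h ↦ (hZ's h).2 rfl
    obtain ⟨Y, hYs, hY, haY⟩ := hZ.strong_elimination hZ' hwZ (hWZ' ⟨hwZ, hw⟩) haZ haZ'
    have hYsub : Y ⊆ Z ∪ C ∪ D := fun u hu ↦ by
      have h1 := hYs hu
      have h2 := @hZ's u
      grind
    have hYD : ∀ u ∈ Y, u ∉ D := fun u hu huD ↦
      (hYs (hmin Y hY ⟨a, haY, haC⟩ ⟨u, hu, huD⟩ hYsub ⟨hwZ, hw⟩)).2 rfl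
    have hYC : Y = C := by
      refine hC.eq_of_subset_union_sdiff hZ hCD.symm ⟨d, hdZ, hdD⟩ hmin' hY fun u hu ↦ ?_
      have h1 := hYs hu
      have h2 := @hZ's u
      have h3 := hYD u hu
      grind
    exact hYC ▸ fun u hu ↦ (hYs hu).1

lemma IsCircuit.exists_two_mul_ncard_inter_ge [M.Finite] (hC : M.IsCircuit C) (hD : M.IsCircuit D)
    (hZ : M.IsCircuit Z) (hCD : Disjoint C D) (hZC : (Z ∩ C).Nonempty) (hZD : (Z ∩ D).Nonempty)
    (hmin : ∀ Y, M.IsCircuit Y → (Y ∩ C).Nonempty → (Y ∩ D).Nonempty → Y ⊆ Z ∪ C ∪ D →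
      Z \ (C ∪ D) ⊆ Y) (hW : (Z \ (C ∪ D)).Nonempty) :
    ∃ Z', M.IsCircuit Z' ∧ (Z' ∩ C).Nonempty ∧ Z' \ C = Z \ C ∧
      C.ncard ≤ 2 * (Z' ∩ C).ncard := by
  obtain ⟨Z', hZ', hne, hdiff, hcov⟩ := hC.exists_complementary hD hZ hCD hZC hZD hmin hW
  have hfin : C.Finite := M.ground_finite.subset hC.subset_ground
  have hle : C.ncard ≤ (Z ∩ C).ncard + (Z' ∩ C).ncard := by
    refine le_trans (ncard_le_ncard ?_ ?_) (ncard_union_le _ _)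
    · exact fun u hu ↦ (hcov hu).imp (⟨·, hu⟩) (⟨·, hu⟩)
    · exact (hfin.subset inter_subset_right).union (hfin.subset inter_subset_right)
  rcases le_total (Z ∩ C).ncard (Z' ∩ C).ncard with h | h
  · exact ⟨Z', hZ', hne, hdiff, by omega⟩
  · exact ⟨Z, hZ, hZC, rfl, by omega⟩

/-- If `C` and `D` are disjoint circuits that are the only circuits in `C ∪ D`, and some circuit
meets both, then there is a circuit with more than `(|C| + |D|) / 2` elements. -/
lemma IsCircuit.exists_ncard_add_ncard_lt [M.Finite] (hC : M.IsCircuit C) (hD : M.IsCircuit D)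
    (hCD : Disjoint C D) (hskew : ∀ Y, M.IsCircuit Y → Y ⊆ C ∪ D → Y = C ∨ Y = D)
    (hex : ∃ Z, M.IsCircuit Z ∧ (Z ∩ C).Nonempty ∧ (Z ∩ D).Nonempty) :
    ∃ Z, M.IsCircuit Z ∧ C.ncard + D.ncard < 2 * Z.ncard := by
  have hfin : ∀ Z, M.IsCircuit Z → Z.Finite := fun Z hZ ↦ M.ground_finite.subset hZ.subset_ground
  obtain ⟨Z, ⟨hZ, hZC, hZD⟩, hZmin⟩ := exists_minimalFor_of_wellFoundedLT
    (fun Z ↦ M.IsCircuit Z ∧ (Z ∩ C).Nonempty ∧ (Z ∩ D).Nonempty)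
    (fun Z ↦ (Z \ (C ∪ D)).ncard) hex
  have hmin : ∀ Y, M.IsCircuit Y → (Y ∩ C).Nonempty → (Y ∩ D).Nonempty → Y ⊆ Z ∪ C ∪ D →
      Z \ (C ∪ D) ⊆ Y := by
    intro Y hY hYC hYD hYs
    have hsub : Y \ (C ∪ D) ⊆ Z \ (C ∪ D) := fun u hu ↦ by
      have := hYs hu.1
      grind
    have hle := ncard_le_ncard hsub ((hfin Z hZ).subset sdiff_subset)
    have := eq_of_subset_of_ncard_le hsub (hZmin ⟨hY, hYC, hYD⟩ hle)
      ((hfin Z hZ).subset sdiff_subset)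
    exact this ▸ sdiff_subset
  have hW : (Z \ (C ∪ D)).Nonempty := by
    by_contra! h
    rw [sdiff_eq_empty] at h
    rcases hskew Z hZ h with rfl | rfl
    · exact hZD.ne_empty hCD.inter_eq
    · exact hZC.ne_empty hCD.symm.inter_eq
  obtain ⟨Z₁, hZ₁, hZ₁C, hdiff₁, hcard₁⟩ :=
    hC.exists_two_mul_ncard_inter_ge hD hZ hCD hZC hZD hmin hW
  have hmem₁ : ∀ u, u ∉ C → (u ∈ Z₁ ↔ u ∈ Z) := fun u hu ↦ by
    have := Set.ext_iff.1 hdiff₁ u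
    grind
  have hZ₁D : Z₁ ∩ D = Z ∩ D := by
    ext u
    have := hmem₁ u
    have := fun h : u ∈ C ↦ disjoint_left.1 hCD h
    grind
  have hW₁ : Z₁ \ (D ∪ C) = Z \ (C ∪ D) := by
    ext u
    have := hmem₁ u
    grind
  obtain ⟨Z₂, hZ₂, hZ₂D, hdiff₂, hcard₂⟩ :=
    hD.exists_two_mul_ncard_inter_ge hC hZ₁ hCD.symm (hZ₁D ▸ hZD) hZ₁C (fun Y hY h1 h2 hs ↦ by
      rw [hW₁]
      refine hmin Y hY h2 h1 fun u hu ↦ ?_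
      have := hs hu
      have := hmem₁ u
      grind) (hW₁ ▸ hW)
  have hmem₂ : ∀ u, u ∉ D → (u ∈ Z₂ ↔ u ∈ Z₁) := fun u hu ↦ by
    have := Set.ext_iff.1 hdiff₂ u
    grind
  refine ⟨Z₂, hZ₂, ?_⟩
  obtain ⟨w, hw⟩ := hW
  have hsplit : (Z₂ ∩ D).ncard + (Z₁ ∩ C).ncard + 1 ≤ Z₂.ncard := by
    rw [← ncard_union_eq (hCD.symm.mono inter_subset_right inter_subset_right)
      ((hfin _ hZ₂).subset inter_subset_left) ((hfin _ hZ₁).subset inter_subset_left)]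
    refine ncard_lt_ncard ⟨?_, fun h ↦ ?_⟩ (hfin _ hZ₂)
    · rintro u (hu | hu)
      · exact hu.1
      · exact (hmem₂ u (disjoint_left.1 hCD hu.2)).2 hu.1
    · have hwZ₂ : w ∈ Z₂ := (hmem₂ w fun h ↦ hw.2 (Or.inr h)).2
        ((hmem₁ w fun h ↦ hw.2 (Or.inl h)).2 hw.1)
      rcases h hwZ₂ with h | h
      · exact hw.2 (Or.inr h.2)
      · exact hw.2 (Or.inl h.2)
  omega

/-- In a matroid in which any two elements are in a common circuit, contracting a basis of a
largest circuit leaves only smaller circuits. -/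
lemma IsCircuit.ncard_le_of_contract [M.Finite] {n : ℕ} (hn : 1 ≤ n)
    (hconn : ∀ x ∈ M.E, ∀ y ∈ M.E, x ≠ y → ∃ Z, M.IsCircuit Z ∧ x ∈ Z ∧ y ∈ Z)
    (hmax : ∀ Z, M.IsCircuit Z → Z.ncard ≤ n + 1) (hC : M.IsCircuit C) (hCn : C.ncard = n + 1)
    (he : e ∈ C) (hD : (M ／ (C \ {e})).IsCircuit D) : D.ncard ≤ n := by
  by_contra! hDn
  have hfin : ∀ Z, M.IsCircuit Z → Z.Finite := fun Z hZ ↦ M.ground_finite.subset hZ.subset_ground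
  have hI : M.Indep (C \ {e}) := hC.sdiff_singleton_indep he
  have hDI : Disjoint D (C \ {e}) := by
    have := hD.subset_ground
    rw [contract_ground, subset_sdiff] at this
    exact this.2
  have heloop : (M ／ (C \ {e})).IsCircuit {e} := by
    have := hC.contract_isCircuit (C := C \ {e}) (sdiff_singleton_ssubset.2 he)
    rwa [sdiff_sdiff_cancel_left (singleton_subset_iff.2 he)] at this
  have heD : e ∉ D := fun h ↦ by
    have := heloop.eq_of_subset_isCircuit hD (singleton_subset_iff.2 h)
    rw [← this, ncard_singleton] at hDn
    omega
  have hCD : Disjoint C D := disjoint_left.2 fun u huC huD ↦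
    disjoint_left.1 hDI huD ⟨huC, fun h ↦ heD (h ▸ huD)⟩
  -- a circuit of `M` in `D ∪ (C \ {e})` contains `D`
  have hcont : ∀ Y, M.IsCircuit Y → Y ⊆ D ∪ (C \ {e}) → D ⊆ Y := by
    intro Y hY hYs u hu
    by_contra huY
    have hind := hD.sdiff_singleton_indep hu
    rw [hI.contract_indep_iff] at hind
    refine (hind.2.subset fun v hv ↦ ?_).not_dep hY.dep
    rcases hYs hv with h | h
    · exact Or.inl ⟨h, fun hvu ↦ huY (hvu ▸ hv)⟩
    · exact Or.inr h
  have hDcirc : M.IsCircuit D := by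
    obtain ⟨Y, hYs, hY⟩ := (hI.contract_dep_iff.1 hD.dep).2.exists_isCircuit_subset
    have hDY := hcont Y hY (hYs.trans (by simp))
    have hle := hmax Y hY
    have := eq_of_subset_of_ncard_le hDY (by omega) (hfin Y hY)
    exact this ▸ hY
  have hskew : ∀ Y, M.IsCircuit Y → Y ⊆ C ∪ D → Y = C ∨ Y = D := by
    intro Y hY hYs
    by_cases hYC : Y ⊆ C
    · exact Or.inl (hY.eq_of_subset_isCircuit hC hYC)
    right
    obtain ⟨d, hdY, hdC⟩ := not_subset.1 hYC
    refine (hDcirc.eq_of_subset_isCircuit hY ?_).symm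
    by_cases heY : e ∈ Y
    · obtain ⟨Y', hY's, hY', hdY'⟩ := hY.strong_elimination hC heY he hdY hdC
      have hDY' : D ⊆ Y' := hcont Y' hY' fun u hu ↦ by
        have h1 := hY's hu
        have h2 := @hYs u
        grind
      exact fun u hu ↦ (hY's (hDY' hu)).1.resolve_right fun h ↦ disjoint_left.1 hCD h hu
    · refine hcont Y hY fun u hu ↦ ?_
      have h1 := hYs hu
      grind
  obtain ⟨d, hd⟩ := hDcirc.nonempty
  obtain ⟨Z₀, hZ₀, heZ₀, hdZ₀⟩ := hconn e (hC.subset_ground he) d (hDcirc.subset_ground hd)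
    fun h ↦ heD (h ▸ hd)
  obtain ⟨Z, hZ, hlt⟩ := hC.exists_ncard_add_ncard_lt hDcirc hCD hskew
    ⟨Z₀, hZ₀, ⟨e, heZ₀, he⟩, ⟨d, hdZ₀, hd⟩⟩
  have := hmax Z hZ
  omega

end Matroid

namespace Matroid

open Set

variable {α : Type*} {M : Matroid α} {I S X : Set α} {e : α} {N N₁ N₂ : Set (List ℕ)}
  {f f₁ f₂ : α → List ℕ} {d d₁ d₂ : ℕ}

/-- The nonempty suffixes of the lists `f x` with `x ∈ X`. -/
def suffixSet (f : α → List ℕ) (X : Set α) : Set (List ℕ) :=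
  {l | l ≠ [] ∧ ∃ x ∈ X, l <:+ f x}

/-- A depth-decomposition of `M` of depth at most `d` in which the vertices of the tree are lists,
the root is the empty list, and the parent of a nonempty list is its tail. -/
structure IsListDecomposition (M : Matroid α) (N : Set (List ℕ)) (f : α → List ℕ) (d : ℕ) :
    Prop where
  finite : N.Finite
  nil_mem : [] ∈ N
  tail_mem : ∀ l ∈ N, l.tail ∈ N
  length_le : ∀ l ∈ N, l.length ≤ d
  map_mem : ∀ x, f x ∈ N
  eRank_eq : M.eRank = (N \ {[]}).encard
  eRk_le : ∀ X ⊆ M.E, M.eRk X ≤ (suffixSet f X).encard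

lemma IsListDecomposition.mem_of_suffix (h : M.IsListDecomposition N f d) {l l' : List ℕ}
    (hl : l ∈ N) (hl' : l' <:+ l) : l' ∈ N := by
  induction l with
  | nil => simpa [List.suffix_nil.1 hl'] using hl
  | cons a l ih =>
    rcases List.suffix_cons_iff.1 hl' with rfl | h'
    · exact hl
    · exact ih (h.tail_mem _ hl) h'

lemma IsListDecomposition.mono (h : M.IsListDecomposition N f d₁) (hd : d₁ ≤ d₂) :
    M.IsListDecomposition N f d₂ :=
  { h with length_le := fun l hl ↦ (h.length_le l hl).trans hd }

lemma isListDecomposition_of_eRank_eq_zero (h : M.eRank = 0) :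
    M.IsListDecomposition {[]} (fun _ ↦ []) 0 where
  finite := finite_singleton _
  nil_mem := rfl
  tail_mem := by simp
  length_le := by simp
  map_mem := by simp
  eRank_eq := by simp [h]
  eRk_le X _ := by
    have := M.eRk_le_eRank X
    rw [h, nonpos_iff_eq_zero] at this
    simp [this]

lemma IsNonloop.eRk_insert_eq_contract (he : M.IsNonloop e) (hX : X ⊆ M.E) :
    M.eRk (insert e X) = (M ／ {e}).eRk (X \ {e}) + 1 := by
  obtain ⟨J, hJ⟩ := (M ／ {e}).exists_isBasis (X \ {e}) (sdiff_subset_sdiff_left hX)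
  have hb := he.indep.union_isBasis_union_of_contract_isBasis hJ
  have heJ : e ∉ J := fun h ↦ (hJ.subset h).2 rfl
  rw [sdiff_union_self, union_singleton, union_singleton] at hb
  rw [← hb.encard_eq_eRk, ← hJ.encard_eq_eRk, encard_insert_of_notMem heJ]

/-- Extending a decomposition of `M ／ {e}` by a new root. -/
lemma IsListDecomposition.of_contract_singleton (he : M.IsNonloop e)
    (h : (M ／ {e}).IsListDecomposition N f d) :
    M.IsListDecomposition (insert [] ((· ++ [0]) '' N)) (fun x ↦ f x ++ [0]) (d + 1) where
  finite := (h.finite.image _).insert _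
  nil_mem := mem_insert _ _
  tail_mem := by
    rintro _ (rfl | ⟨l, hl, rfl⟩)
    · exact mem_insert _ _
    · cases l with
      | nil => exact mem_insert _ _
      | cons a l => exact Or.inr ⟨l, h.tail_mem _ hl, rfl⟩
  length_le := by
    rintro _ (rfl | ⟨l, hl, rfl⟩)
    · simp
    · simpa using h.length_le l hl
  map_mem x := Or.inr ⟨_, h.map_mem x, rfl⟩
  eRank_eq := by
    have hinj : Function.Injective (fun l : List ℕ ↦ l ++ [0]) := List.append_left_injective _
    have hnil : ([] : List ℕ) ∉ (· ++ [0]) '' N := by simp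
    rw [insert_sdiff_of_mem _ (mem_singleton _), sdiff_singleton_eq_self hnil, hinj.encard_image,
      ← encard_sdiff_singleton_add_one h.nil_mem, ← h.eRank_eq, ← eRk_ground, ← eRk_ground,
      contract_ground, ← he.eRk_insert_eq_contract subset_rfl, insert_eq_of_mem he.mem_ground]
  eRk_le X hX := by
    obtain rfl | ⟨x, hx⟩ := X.eq_empty_or_nonempty
    · simp
    have hinj : Function.Injective (fun l : List ℕ ↦ l ++ [0]) := List.append_left_injective _
    have hnil : [] ∉ suffixSet f X := fun h ↦ h.1 rfl
    calc M.eRk X ≤ M.eRk (insert e X) := M.eRk_mono (subset_insert _ _)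
      _ = (M ／ {e}).eRk (X \ {e}) + 1 := he.eRk_insert_eq_contract hX
      _ ≤ (suffixSet f (X \ {e})).encard + 1 := by
          gcongr
          exact h.eRk_le _ (sdiff_subset_sdiff_left hX)
      _ ≤ (suffixSet f X).encard + 1 := by
          gcongr
          exact fun l ⟨hl, y, hy, hly⟩ ↦ ⟨hl, y, hy.1, hly⟩
      _ = ((· ++ [0]) '' insert [] (suffixSet f X)).encard := by
          rw [hinj.encard_image, encard_insert_of_notMem hnil]
      _ ≤ _ := by
          refine encard_le_encard ?_
          rintro _ ⟨l, rfl | ⟨hl, y, hy, hly⟩, rfl⟩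
          · exact ⟨by simp, x, hx, List.suffix_append _ _⟩
          · refine ⟨by simp, y, hy, ?_⟩
            obtain ⟨t, ht⟩ := hly
            exact ⟨t, by simp [← ht]⟩

lemma exists_isListDecomposition_of_contract (hIfin : I.Finite) (hI : M.Indep I)
    (h : ∃ N f, (M ／ I).IsListDecomposition N f d) :
    ∃ N f, M.IsListDecomposition N f (d + I.ncard) := by
  induction I, hIfin using Set.Finite.induction_on generalizing d with
  | empty => simpa using h
  | @insert e I heI hfin ih =>
    obtain ⟨N, f, hN⟩ := h
    have hI' := hI.subset (subset_insert e I)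
    rw [← union_singleton, ← contract_contract] at hN
    have he : (M ／ I).IsNonloop e := by
      rw [← indep_singleton, hI'.contract_indep_iff]
      exact ⟨by simpa using heI, by simpa using hI⟩
    obtain ⟨N', f', h'⟩ := ih hI' ⟨_, _, hN.of_contract_singleton he⟩
    refine ⟨N', f', h'.mono ?_⟩
    rw [ncard_insert_of_notMem heI hfin]
    omega

lemma exists_isListDecomposition_of_eRank_le [M.Finite] (h : M.eRank ≤ d) :
    ∃ N f, M.IsListDecomposition N f d := by
  obtain ⟨B, hB⟩ := M.exists_isBase
  have hfin : B.Finite := M.ground_finite.subset hB.subset_ground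
  obtain ⟨N, f, hN⟩ := exists_isListDecomposition_of_contract hfin hB.indep
    ⟨_, _, isListDecomposition_of_eRank_eq_zero (M := M ／ B)
      (by rw [hB.spanning.contract_eq_loopyOn, eRank_loopyOn])⟩
  refine ⟨N, f, hN.mono ?_⟩
  rw [← hB.encard_eq_eRank, ← hfin.cast_ncard_eq] at h
  simpa using h

lemma encard_union_image_map (A B : Set (List ℕ)) (hA : [] ∉ A) :
    (List.map (2 * ·) '' A ∪ List.map (2 * · + 1) '' B).encard = A.encard + B.encard := by
  have h₁ : Function.Injective (List.map (fun n : ℕ ↦ 2 * n)) :=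
    List.map_injective_iff.2 fun a b h ↦ by simpa using h
  have h₂ : Function.Injective (List.map (fun n : ℕ ↦ 2 * n + 1)) :=
    List.map_injective_iff.2 fun a b h ↦ by simpa using h
  rw [encard_union_eq, h₁.encard_image, h₂.encard_image]
  rw [disjoint_left]
  rintro _ ⟨l, hl, rfl⟩ ⟨l', hl', h⟩
  cases l with
  | nil => exact hA hl
  | cons a l =>
    cases l' with
    | nil => simp at h
    | cons b l' =>
      simp only [List.map_cons, List.cons.injEq] at h
      omega

/-- Gluing decompositions of the two sides of a separation at their roots. -/
lemma IsListDecomposition.of_separation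
    (hr : M.eRk S + M.eRk (M.E \ S) = M.eRank)
    (h₁ : (M ↾ S).IsListDecomposition N₁ f₁ d)
    (h₂ : (M ↾ (M.E \ S)).IsListDecomposition N₂ f₂ d) [DecidablePred (· ∈ S)] :
    M.IsListDecomposition (List.map (2 * ·) '' N₁ ∪ List.map (2 * · + 1) '' N₂)
      (fun x ↦ if x ∈ S then (f₁ x).map (2 * ·) else (f₂ x).map (2 * · + 1)) d where
  finite := (h₁.finite.image _).union (h₂.finite.image _)
  nil_mem := Or.inl ⟨[], h₁.nil_mem, rfl⟩
  tail_mem := by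
    rintro _ (⟨l, hl, rfl⟩ | ⟨l, hl, rfl⟩)
    · exact Or.inl ⟨_, h₁.tail_mem l hl, List.map_tail⟩
    · exact Or.inr ⟨_, h₂.tail_mem l hl, List.map_tail⟩
  length_le := by
    rintro _ (⟨l, hl, rfl⟩ | ⟨l, hl, rfl⟩)
    · simpa using h₁.length_le l hl
    · simpa using h₂.length_le l hl
  map_mem x := by
    split_ifs
    · exact Or.inl ⟨_, h₁.map_mem x, rfl⟩
    · exact Or.inr ⟨_, h₂.map_mem x, rfl⟩
  eRank_eq := by
    have hdiff (g : ℕ → ℕ) (N : Set (List ℕ)) :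
        List.map g '' N \ {[]} = List.map g '' (N \ {[]}) := by
      ext l
      constructor
      · rintro ⟨⟨l, hl, rfl⟩, h⟩
        exact ⟨l, ⟨hl, by simpa using h⟩, rfl⟩
      · rintro ⟨l, ⟨hl, h⟩, rfl⟩
        exact ⟨⟨l, hl, rfl⟩, by simpa using h⟩
    rw [union_sdiff_distrib, hdiff, hdiff, encard_union_image_map _ _ (by simp), ← h₁.eRank_eq,
      ← h₂.eRank_eq, eRank_restrict, eRank_restrict, hr]
  eRk_le X hX := by
    calc M.eRk X ≤ M.eRk (X ∩ S) + M.eRk (X \ S) := M.eRk_le_eRk_inter_add_eRk_sdiff X S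
      _ ≤ (suffixSet f₁ (X ∩ S)).encard + (suffixSet f₂ (X \ S)).encard := by
          gcongr
          · rw [← M.restrict_eRk_eq (inter_subset_right : X ∩ S ⊆ S)]
            exact h₁.eRk_le _ inter_subset_right
          · rw [← M.restrict_eRk_eq (sdiff_subset_sdiff_left hX : X \ S ⊆ M.E \ S)]
            exact h₂.eRk_le _ (sdiff_subset_sdiff_left hX)
      _ = _ := (encard_union_image_map _ _ fun h ↦ h.1 rfl).symm
      _ ≤ _ := by
          refine encard_le_encard ?_
          rintro _ (⟨l, ⟨hl, x, hx, hlx⟩, rfl⟩ | ⟨l, ⟨hl, x, hx, hlx⟩, rfl⟩)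
          · exact ⟨by simpa using hl, x, hx.1, by simpa [hx.2] using hlx.map _⟩
          · exact ⟨by simpa using hl, x, hx.1, by simpa [hx.2] using hlx.map _⟩

/-- The tree on a set of lists in which a nonempty list is adjacent to its tail. -/
def listTree (N : Set (List ℕ)) : SimpleGraph N :=
  SimpleGraph.fromRel fun u v ↦ u.1.tail = v.1

lemma IsListDecomposition.exists_isPath (h : M.IsListDecomposition N f d) (l : List ℕ)
    (hl : l ∈ N) : ∃ p : (listTree N).Walk ⟨l, hl⟩ ⟨[], h.nil_mem⟩, p.IsPath ∧
      p.length = l.length ∧ (∀ w ∈ p.support, w.1 <:+ l) ∧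
      ∀ v : N, v.1 ≠ [] → v.1 <:+ l → s(v, ⟨v.1.tail, h.tail_mem _ v.2⟩) ∈ p.edges := by
  induction l with
  | nil =>
    refine ⟨.nil, .nil, rfl, by simp, fun v hv hv' ↦ absurd (List.suffix_nil.1 hv') hv⟩
  | cons a l ih =>
    obtain ⟨p, hp, hlen, hsupp, hedge⟩ := ih (h.tail_mem _ hl)
    have hadj : (listTree N).Adj ⟨a :: l, hl⟩ ⟨l, h.tail_mem _ hl⟩ := by
      rw [listTree, SimpleGraph.fromRel_adj]
      exact ⟨fun h0 ↦ List.cons_ne_self a l (congrArg Subtype.val h0), Or.inl rfl⟩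
    refine ⟨.cons hadj p, (SimpleGraph.Walk.cons_isPath_iff _ _).2 ⟨hp, fun hmem ↦ ?_⟩,
      by simp [hlen], fun w hw ↦ ?_, fun v hv hv' ↦ ?_⟩
    · have := (hsupp _ hmem).length_le
      simp at this
    · rw [SimpleGraph.Walk.support_cons, List.mem_cons] at hw
      rcases hw with rfl | hw
      · exact List.suffix_rfl
      · exact (hsupp w hw).trans (List.suffix_cons _ _)
    · rw [SimpleGraph.Walk.edges_cons, List.mem_cons]
      rcases List.suffix_cons_iff.1 hv' with hv' | hv'
      · left
        obtain ⟨v, hvN⟩ := v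
        obtain rfl : v = a :: l := hv'
        rfl
      · exact Or.inr (hedge v hv hv')

lemma IsListDecomposition.injOn_parentEdge (h : M.IsListDecomposition N f d) :
    InjOn (fun v : N ↦ s(v, (⟨v.1.tail, h.tail_mem _ v.2⟩ : N))) {v | v.1 ≠ []} := by
  rintro ⟨u, hu⟩ hu' ⟨v, hv⟩ hv' huv
  simp only [Sym2.eq_iff, Subtype.mk.injEq] at huv
  rcases huv with huv | ⟨h1, h2⟩
  · exact Subtype.ext huv.1
  · have hu0 : u ≠ [] := hu'
    have := List.length_pos_iff.2 hu0
    have h3 := congrArg List.length h1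
    have h4 := congrArg List.length h2
    simp only [List.length_tail] at h3 h4
    omega

lemma IsListDecomposition.edgeSet_eq (h : M.IsListDecomposition N f d) :
    (listTree N).edgeSet =
      (fun v : N ↦ s(v, (⟨v.1.tail, h.tail_mem _ v.2⟩ : N))) '' {v | v.1 ≠ []} := by
  have hne : ∀ {u v : N}, u ≠ v → u.1.tail = v.1 → u.1 ≠ [] := fun {u v} huv ht h0 ↦
    huv (Subtype.ext (by rw [← ht, h0]; rfl))
  ext e
  induction e using Sym2.ind with
  | _ u v =>
  rw [SimpleGraph.mem_edgeSet, listTree, SimpleGraph.fromRel_adj]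
  constructor
  · rintro ⟨huv, ht | ht⟩
    · refine ⟨u, hne huv ht, ?_⟩
      simp [ht]
    · refine ⟨v, hne huv.symm ht, ?_⟩
      simp [ht, Sym2.eq_swap]
  · rintro ⟨w, hw, hwe⟩
    have hwt : w.1 ≠ w.1.tail := fun h0 ↦ by
      have := List.length_pos_iff.2 hw
      have := congrArg List.length h0
      simp only [List.length_tail] at this
      omega
    rcases Sym2.eq_iff.1 hwe with ⟨rfl, rfl⟩ | ⟨rfl, rfl⟩
    · exact ⟨fun h0 ↦ hwt (congrArg Subtype.val h0), Or.inl rfl⟩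
    · exact ⟨fun h0 ↦ hwt (congrArg Subtype.val h0.symm), Or.inr rfl⟩

lemma IsListDecomposition.encard_edgeSet (h : M.IsListDecomposition N f d) :
    (listTree N).edgeSet.encard = (N \ {[]}).encard := by
  rw [h.edgeSet_eq, h.injOn_parentEdge.encard_image, ← Subtype.val_injective.encard_image]
  congr 1
  ext l
  simp [and_comm]

lemma IsListDecomposition.isTree (h : M.IsListDecomposition N f d) : (listTree N).IsTree := by
  have := h.finite.to_subtype
  rw [SimpleGraph.isTree_iff_connected_and_card]
  constructor
  · have hr : ∀ v : N, (listTree N).Reachable v ⟨[], h.nil_mem⟩ := fun v ↦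
      (h.exists_isPath v.1 v.2).choose.reachable
    exact { preconnected := fun u v ↦ (hr u).trans (hr v).symm, nonempty := ⟨⟨[], h.nil_mem⟩⟩ }
  · rw [Nat.card_coe_set_eq, Nat.card_coe_set_eq, ncard_def, h.encard_edgeSet, ← ncard_def,
      ncard_sdiff_singleton_add_one h.nil_mem h.finite]

lemma IsListDecomposition.isDepthDecomposition (h : M.IsListDecomposition N f d) :
    M.IsDepthDecomposition (listTree N) ⟨[], h.nil_mem⟩ fun x ↦ ⟨f x, h.map_mem x⟩ where
  isTree := h.isTree
  eRank_eq := by rw [h.encard_edgeSet, h.eRank_eq]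
  eRk_le X hX := by
    refine (h.eRk_le X hX).trans ?_
    have himage : suffixSet f X = Subtype.val '' {v : N | v.1 ∈ suffixSet f X} := by
      ext l
      simp only [mem_image, mem_ofPred_eq, Subtype.exists, exists_and_right, exists_eq_right,
        exists_prop]
      exact ⟨fun hl ↦ ⟨hl.2.elim fun x hx ↦ h.mem_of_suffix (h.map_mem x) hx.2, hl⟩, And.right⟩
    rw [himage, Subtype.val_injective.encard_image,
      ← (h.injOn_parentEdge.mono fun v hv ↦ hv.1).encard_image]
    refine encard_le_encard ?_
    rintro _ ⟨v, ⟨hv, x, hx, hvx⟩, rfl⟩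
    obtain ⟨p, hp, -, -, hedge⟩ := h.exists_isPath (f x) (h.map_mem x)
    refine ⟨_, mem_image_of_mem _ hx, ⟨p.reverse, hp.reverse⟩, ?_⟩
    simpa using hedge v hv hvx

lemma IsListDecomposition.branchDepth_le (h : M.IsListDecomposition N f d) :
    M.branchDepth ≤ d := by
  refine le_trans (b := (listTree N).rootedDepth ⟨[], h.nil_mem⟩)
    (sInf_le ⟨N, h.finite.to_subtype, _, _, _, h.isDepthDecomposition, rfl⟩) ?_
  refine iSup_le fun v ↦ iSup_le fun q ↦ ?_
  obtain ⟨p, hp, hlen, -⟩ := h.exists_isPath v.1 v.2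
  have := h.isTree.isAcyclic.subsingleton_path ⟨[], h.nil_mem⟩ v
  rw [Subsingleton.elim q ⟨p.reverse, hp.reverse⟩]
  simpa [hlen] using h.length_le v.1 v.2

/-- To decompose all matroids with circuits of size at most `n`, it suffices to decompose those
in which any two elements are in a common circuit. -/
lemma exists_isListDecomposition_of_forall_connected {n : ℕ}
    (h : ∀ (M : Matroid α) [M.Finite], (∀ C, M.IsCircuit C → C.ncard ≤ n) →
      (∀ x ∈ M.E, ∀ y ∈ M.E, x ≠ y → ∃ Z, M.IsCircuit Z ∧ x ∈ Z ∧ y ∈ Z) →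
      ∃ N f, M.IsListDecomposition N f d)
    (M : Matroid α) [M.Finite] (hM : ∀ C, M.IsCircuit C → C.ncard ≤ n) :
    ∃ N f, M.IsListDecomposition N f d := by
  classical
  induction hm : M.E.ncard using Nat.strong_induction_on generalizing M with
  | _ m ih =>
  by_cases hconn : ∀ x ∈ M.E, ∀ y ∈ M.E, x ≠ y → ∃ Z, M.IsCircuit Z ∧ x ∈ Z ∧ y ∈ Z
  · exact h M hM hconn
  push Not at hconn
  obtain ⟨x, hx, y, hy, hxy, hno⟩ := hconn
  obtain ⟨S, hS, hxS, hyS, hr⟩ := M.exists_eRk_add_eRk_compl_eq hx hxy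
    fun ⟨Z, hZ, h1, h2⟩ ↦ hno Z hZ h1 h2
  have hrestr : ∀ R ⊂ M.E, ∃ N f, (M ↾ R).IsListDecomposition N f d := by
    intro R hR
    have : (M ↾ R).Finite := ⟨M.ground_finite.subset hR.subset⟩
    refine ih _ ?_ (M ↾ R) (fun C hC ↦ hM C ?_) rfl
    · rw [← hm]
      exact ncard_lt_ncard hR M.ground_finite
    · exact ((restrict_isCircuit_iff hR.subset).1 hC).1
  obtain ⟨N₁, f₁, h₁⟩ := hrestr S ⟨hS, fun h ↦ hyS (h hy)⟩
  obtain ⟨N₂, f₂, h₂⟩ := hrestr (M.E \ S) ⟨sdiff_subset, fun h ↦ (h hx).2 hxS⟩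
  exact ⟨_, _, h₁.of_separation hr h₂⟩

/-- A matroid whose circuits have at most `n` elements has a decomposition of depth `n ^ 2`. -/
lemma exists_isListDecomposition_sq {n : ℕ} (hn : 1 ≤ n) (M : Matroid α) [M.Finite]
    (hM : ∀ C, M.IsCircuit C → C.ncard ≤ n) : ∃ N f, M.IsListDecomposition N f (n ^ 2) := by
  induction n, hn using Nat.le_induction generalizing M with
  | base =>
    refine exists_isListDecomposition_of_forall_connected (fun M _ hM hconn ↦ ?_) M hM
    refine exists_isListDecomposition_of_eRank_le (M.eRank_le_encard_ground.trans ?_)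
    rw [one_pow, Nat.cast_one, encard_le_one_iff]
    intro x y hx hy
    by_contra hxy
    obtain ⟨Z, hZ, hxZ, hyZ⟩ := hconn x hx y hy hxy
    exact hxy ((ncard_le_one (M.ground_finite.subset hZ.subset_ground)).1 (hM Z hZ) x hxZ y hyZ)
  | succ n hn ih =>
    refine exists_isListDecomposition_of_forall_connected (fun M _ hM hconn ↦ ?_) M hM
    by_cases hlt : ∀ C, M.IsCircuit C → C.ncard ≤ n
    · obtain ⟨N, f, h⟩ := ih M hlt
      exact ⟨N, f, h.mono (Nat.pow_le_pow_left n.le_succ 2)⟩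
    push Not at hlt
    obtain ⟨C, hC, hCn⟩ := hlt
    have hCcard : C.ncard = n + 1 := le_antisymm (hM C hC) hCn
    have hCfin : C.Finite := M.ground_finite.subset hC.subset_ground
    obtain ⟨e, he⟩ := hC.nonempty
    obtain ⟨N, f, h⟩ := exists_isListDecomposition_of_contract (hCfin.sdiff (t := {e}))
      (hC.sdiff_singleton_indep he) (ih (M ／ (C \ {e})) fun D hD ↦
        hC.ncard_le_of_contract hn hconn hM hCcard he hD)
    refine ⟨N, f, h.mono ?_⟩
    rw [ncard_sdiff_singleton_of_mem he, hCcard, Nat.add_sub_cancel]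
    nlinarith

end Matroid

theorem mainTheorem5 {α : Type*} (M : Matroid α) [M.Finite] (ℓ : ℕ)
    (hℓ : IsGreatest {k : ℕ | ∃ C : Set α, M.IsCircuit C ∧ C.encard = k} ℓ) :
    M.branchDepth ≤ (ℓ : ℕ∞) ^ 2 := by
  have hfin : ∀ C, M.IsCircuit C → C.Finite := fun C hC ↦ M.ground_finite.subset hC.subset_ground
  have hpos : 1 ≤ ℓ := by
    obtain ⟨C, hC, hcard⟩ := hℓ.1
    rw [Nat.one_le_iff_ne_zero]
    rintro rfl
    exact hC.nonempty.ne_empty (by simpa using hcard)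
  obtain ⟨N, f, h⟩ := M.exists_isListDecomposition_sq hpos fun C hC ↦
    hℓ.2 ⟨C, hC, (hfin C hC).cast_ncard_eq.symm⟩
  simpa using h.branchDepth_le
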